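/- Let $n\ge 0$ and $a\ge 1$ be integers. The extended Shi arrangement $\mathcal{A}^{a,a+1}_{n-1}$ consists of the hyperplanes $$x_i-x_j=1-a,\,2-a,\,\ldots,\,a\qquad(1\le i<j\le n)$$ in $V_{n-1}=\{x\in\mathbb{R}^n : x_1+\cdots+x_n=0\}$; its regions are the connected components of the complement in $V_{n-1}$ of the union of these hyperplanes. To a region $R$ associate the weight function $w$ defined as follows. For $i<j$ let $m_{ij}<x_i-x_j<M_{ij}$ be the bounds satisfied on $R$, where $m_{ij}$ is the largest element of $\{1-a,\ldots,a\}$ below $x_i-x_j$ on $R$ ($-\infty$ if there is none) and $M_{ij}$ is the smallest element of this set above $x_i-x_j$ on $R$ ($+\infty$ if there is none). Put $w(i,j)=m_{ij}$ and $w(j,i)=-M_{ij}$, and $w(i,i)=-\infty$. Write $i\prec_R j$ if $w(i,j)\ge 0$; this is the total order of the indices by decreasing value of the coordinates on $R$. The Pak–Stanley label of $R$ is the vector $(f(1),\ldots,f(n))$ given by $$f(i)=\sum_{j\,:\,i\prec_R j} w(i,j)+\bigl|\{j : i\prec_R j \text{ and } i>j\}\bigr| .$$ An $a$-parking function of length $n$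 is a sequence $(f(1),\ldots,f(n))\in\mathbb{N}^n$ (with $0\in\mathbb{N}$) whose increasing rearrangement $\tilde f(1)\le\cdots\le\tilde f(n)$ satisfies $0\le\tilde f(i)\le a(i-1)$ for all $i$. **Theorem (Stanley).** The Pak–Stanley label of every region of $\mathcal{A}^{a,a+1}_{n-1}$ is an $a$-parking function of length $n$, and every $a$-parking function of length $n$ is the Pak–Stanley label of exactly one region of $\mathcal{A}^{a,a+1}_{n-1}$. -/

import Mathlib

noncomputable section

namespace ExtShi

/-- The subspace `x_1 + ⋯ + x_n = 0` of `ℝ^n`. -/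
def ambient (n : ℕ) : Set (Fin n → ℝ) := {x | ∑ i, x i = 0}

/-- The truncated affine arrangement `A^{a,b}_{n-1}`: the hyperplanes
`x_i - x_j = 1-a, 2-a, …, b-1` for `i < j`, in the subspace `x_1 + ⋯ + x_n = 0`. -/
def truncatedAffine (n : ℕ) (a b : ℤ) : Set (Set (Fin n → ℝ)) :=
  {H | ∃ i j : Fin n, i < j ∧ ∃ m : ℤ, 1 - a ≤ m ∧ m ≤ b - 1 ∧
    H = {x | x ∈ ambient n ∧ x i - x j = (m : ℝ)}}

/-- The extended Shi arrangement `A^{a,a+1}_{n-1}`. -/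
def extendedShi (n a : ℕ) : Set (Set (Fin n → ℝ)) :=
  truncatedAffine n (a : ℤ) ((a : ℤ) + 1)

/-- The complement, in the subspace `x_1 + ⋯ + x_n = 0`, of the union of the hyperplanes. -/
def complement (n : ℕ) (A : Set (Set (Fin n → ℝ))) : Set (Fin n → ℝ) :=
  ambient n \ ⋃₀ A

/-- The regions of an arrangement: the connected components of its complement. -/
def regions (n : ℕ) (A : Set (Set (Fin n → ℝ))) : Set (Set (Fin n → ℝ)) :=
  {R | ∃ x ∈ complement n A, R = connectedComponentIn (complement n A) x}

/-- The possible weights of a directed edge `i → j` for the extended Shi arrangement, i.e. the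
integers `c` such that `x_i - x_j = c` is one of its hyperplanes:
`1-a, …, a` if `i < j` and `-a, …, a-1` if `i > j`. -/
def edgeWeights {n : ℕ} (a : ℕ) (i j : Fin n) : Finset ℤ :=
  if i < j then Finset.Icc (1 - (a : ℤ)) (a : ℤ)
  else if j < i then Finset.Icc (-(a : ℤ)) ((a : ℤ) - 1)
  else ∅

open Classical in
/-- The weight function `w` of the weighted digraph associated to a region `R` of the extended
Shi arrangement: `w i j` is the largest `c` among the possible weights such that
`x_i - x_j > c` on `R`, and it is `⊥` (that is, `-∞`: there is no edge `i → j`) if there is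
no such `c`.

So if `i < j` and `m < x_i - x_j < M` are the bounds that describe `R`, then `w i j = m`
and `w j i = -M`, with `⊥` for an infinite bound. -/
def weight {n : ℕ} (a : ℕ) (R : Set (Fin n → ℝ)) (i j : Fin n) : WithBot ℤ :=
  ((edgeWeights a i j).filter (fun c : ℤ => ∀ x ∈ R, (c : ℝ) < x i - x j)).max

/-- `i` precedes `j` in the total order of gains of a weight function: `w i j ≥ 0`. -/
def Precedes {n : ℕ} (w : Fin n → Fin n → WithBot ℤ) (i j : Fin n) : Prop := 0 ≤ w i j

open Classical in
/-- The Pak–Stanley label of a weight function: `f(i)` is the sum of the weights `w i j` over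
all `j` preceded by `i` in the order of gains (the separations), plus the number of those `j`
with `i > j` (the inversions). All weights `w i j` in the sum are nonnegative integers, so the
default value of `unbotD` is never used. -/
def pakStanleyLabelOfWeight {n : ℕ} (w : Fin n → Fin n → WithBot ℤ) (i : Fin n) : ℤ :=
  (∑ j ∈ Finset.univ.filter (fun j => Precedes w i j), (w i j).unbotD 0)
    + ((Finset.univ.filter (fun j => Precedes w i j ∧ j < i)).card : ℤ)

/-- The Pak–Stanley label `(f(1), …, f(n))` of a region of the extended Shi arrangement. -/
def pakStanleyLabel {n : ℕ} (a : ℕ) (R : Set (Fin n → ℝ)) : Fin n → ℤ :=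
  pakStanleyLabelOfWeight (weight a R)

/-- `f ∈ ℕ^n` is an `a`-parking function: its increasing rearrangement `g` satisfies
`g(i) ≤ a (i - 1)` for `i = 1, …, n` (here `i` is counted from `0`). -/
def IsParkingFunction {n : ℕ} (a : ℕ) (f : Fin n → ℕ) : Prop :=
  ∀ i : Fin n, (f ∘ Tuple.sort f) i ≤ a * (i : ℕ)

end ExtShi

end

/-!
The hyperplanes of the extended Shi arrangement are `x_i = x_j + k` with `k` in a set `gaps a i j`
of `a` nonnegative integers. The value `x_j + k` is called a threshold of `i`. The Pak–Stanley
label of `i` on the region of `x` is the number of thresholds of `i` below `x_i`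
(`pakStanleyLabel_connectedComponentIn`), and a region is the set of points on the same side of
every hyperplane as one of its points (`connectedComponentIn_complement`). Only the indices `j`
with `x_j < x_i` contribute thresholds below `x_i`, at most `a` each, so the label is a parking
function.

A region is recovered from its label by reading the coordinates in increasing order. The fact
behind this is that two thresholds of the same index, coming from indices in a set `S`, are
compared by a hyperplane of the arrangement (`exists_gap_of_thresholds`). Hence, once the region of
the coordinates in `S` is known, the thresholds of `i` from `S` are ordered, and the number of them
below `x_i` determines the position of `x_i`.

*Injectivity.* Let `x` and `y` have the same labels and agree on the set `S` of their `m` smallest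
coordinates, and let `i` and `l` be the next indices for `x` and `y`. If `i < l`, the labels of `i`
show that every threshold of `i` below `y_l` is below `x_i`. The labels of `l` show that some
threshold of `l` lies below `y_l` but not below `x_i`, because `(i, 0)` is one further threshold of
`l` that is below `x_l`. That threshold has `k > 0`, hence is also a threshold of `i`, a
contradiction (`next_not_lt`). So `i = l`, and `x` and `y` agree on one more index
(`sameSideOn_of_pointLabel_eq`).

*Surjectivity.* Given a parking function `f` and coordinates on `S` realizing `f` there, the next
coordinate `t` is placed just below the first value at which some index `l` outside `S` would get
more than `f l` thresholds below it. Then all counts at `t` are at most `f l`, with equality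
for some `l` (`exists_next_value`); the parking condition gives this equality when no count ever
exceeds its bound. The largest such `l` receives the coordinate `t`. The new threshold
`(l, 0)` affects only larger indices, whose counts are still below their bounds, so that the
construction can go on (`IsParkingFunction.exists_point`).
-/

open Finset

namespace ExtShi

variable {n : ℕ}

/-! ### Thresholds -/

/-- The nonnegative integers `k` such that `x_i = x_j + k` is a hyperplane of the extended Shi
arrangement. Every hyperplane arises from exactly one triple `(i, j, k)` with `k ∈ gaps a i j`. -/
def gaps (a : ℕ) (i j : Fin n) : Finset ℕ :=
  if i < j then Icc 1 a else if j < i then range a else ∅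

theorem mem_gaps {a : ℕ} {i j : Fin n} {k : ℕ} :
    k ∈ gaps a i j ↔ (i < j ∧ 1 ≤ k ∧ k ≤ a) ∨ (j < i ∧ k < a) := by
  unfold gaps
  split_ifs with h1 h2
  · simp [h1, h1.not_gt]
  · simp [h1, h2]
  · simp [h1, h2]

theorem card_gaps {a : ℕ} {i j : Fin n} (h : i ≠ j) : (gaps a i j).card = a := by
  unfold gaps
  rcases h.lt_or_gt with h | h
  · simp [h]
  · simp [h, h.not_gt]

theorem ne_of_mem_gaps {a : ℕ} {i j : Fin n} {k : ℕ} (h : k ∈ gaps a i j) : i ≠ j := by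
  rintro rfl
  simp [mem_gaps] at h

/-- Two thresholds `x_j + k` and `x_j' + k'` of the same index `q` are compared by a hyperplane of
the arrangement, so that their order depends only on the region of `x`. -/
theorem exists_gap_of_thresholds {a : ℕ} {q j j' : Fin n} {k k' : ℕ} (hj : j ≠ j')
    (hk : k ∈ gaps a q j) (hk' : k' ∈ gaps a q j') :
    (∃ m ∈ gaps a j' j, k = k' + m) ∨ (∃ m ∈ gaps a j j', k' = k + m) := by
  rw [mem_gaps] at hk hk'
  rcases lt_trichotomy k k' with h | h | h
  · refine Or.inr ⟨k' - k, mem_gaps.2 ?_, by omega⟩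
    omega
  · rcases hj.lt_or_gt with h' | h'
    · exact Or.inl ⟨0, mem_gaps.2 (by omega), by omega⟩
    · exact Or.inr ⟨0, mem_gaps.2 (by omega), by omega⟩
  · refine Or.inl ⟨k - k', mem_gaps.2 ?_, by omega⟩
    omega

/-- The coordinates of `x` indexed by `S` lie on no hyperplane of the arrangement. -/
def IsGenericOn (a : ℕ) (S : Finset (Fin n)) (x : Fin n → ℝ) : Prop :=
  ∀ i ∈ S, ∀ j ∈ S, ∀ k ∈ gaps a i j, x j + k ≠ x i

/-- The coordinates of `x` and `y` indexed by `S` lie on the same side of every hyperplane. -/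
def SameSideOn (a : ℕ) (S : Finset (Fin n)) (x y : Fin n → ℝ) : Prop :=
  ∀ i ∈ S, ∀ j ∈ S, ∀ k ∈ gaps a i j, (x j + k < x i ↔ y j + k < y i)

theorem SameSideOn.symm {a : ℕ} {S : Finset (Fin n)} {x y : Fin n → ℝ}
    (h : SameSideOn a S x y) : SameSideOn a S y x :=
  fun i hi j hj k hk => (h i hi j hj k hk).symm

/-- The thresholds of the index `i` that come from `S`: the pair `(j, k)` stands for the
value `x_j + k`. -/
def thresholds (a : ℕ) (S : Finset (Fin n)) (i : Fin n) : Finset (Σ _ : Fin n, ℕ) :=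
  S.sigma (gaps a i)

/-- The thresholds of `i` coming from `S` that lie below the real number `t`. -/
noncomputable def below (a : ℕ) (S : Finset (Fin n)) (x : Fin n → ℝ) (i : Fin n) (t : ℝ) :
    Finset (Σ _ : Fin n, ℕ) :=
  (thresholds a S i).filter fun p => x p.1 + p.2 < t

theorem mem_below {a : ℕ} {S : Finset (Fin n)} {x : Fin n → ℝ} {i : Fin n} {t : ℝ}
    {p : Σ _ : Fin n, ℕ} :
    p ∈ below a S x i t ↔ (p.1 ∈ S ∧ p.2 ∈ gaps a i p.1) ∧ x p.1 + p.2 < t := by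
  simp [below, thresholds]

/-- The label of `i`, computed from a point `x`: the number of thresholds of `i` below `x_i`. -/
noncomputable def pointLabel (a : ℕ) (S : Finset (Fin n)) (x : Fin n → ℝ) (i : Fin n) : ℕ :=
  (below a S x i (x i)).card

theorem below_mono {a : ℕ} {S S' : Finset (Fin n)} (hS : S ⊆ S') {x : Fin n → ℝ} {i : Fin n}
    {t t' : ℝ} (ht : t ≤ t') : below a S x i t ⊆ below a S' x i t' := by
  intro p hp
  rw [mem_below] at hp ⊢
  exact ⟨⟨hS hp.1.1, hp.1.2⟩, hp.2.trans_le ht⟩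

/-- Distinct thresholds of an index have distinct values at a generic point. -/
theorem IsGenericOn.injOn_thresholds {a : ℕ} {S : Finset (Fin n)} {x : Fin n → ℝ}
    (hx : IsGenericOn a S x) {i : Fin n} {p q : Σ _ : Fin n, ℕ} (hp : p ∈ thresholds a S i)
    (hq : q ∈ thresholds a S i) (h : x p.1 + p.2 = x q.1 + q.2) : p = q := by
  obtain ⟨j, k⟩ := p
  obtain ⟨j', k'⟩ := q
  simp only [thresholds, mem_sigma] at hp hq h
  by_cases hj : j = j'
  · subst hj
    have : (k : ℝ) = k' := by linarith
    rw [Nat.cast_inj] at this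
    rw [this]
  · exfalso
    rcases exists_gap_of_thresholds hj hp.2 hq.2 with ⟨m, hm, rfl⟩ | ⟨m, hm, rfl⟩
    · refine hx _ hq.1 _ hp.1 m hm ?_
      push_cast at h
      linarith
    · refine hx _ hp.1 _ hq.1 m hm ?_
      push_cast at h
      linarith

/-- If `x` and `y` are in the same region as far as `S` is concerned, the thresholds of `i` are in
the same order for both, so the sets of thresholds below given values are initial segments of a
common chain. -/
theorem SameSideOn.below_total {a : ℕ} {S : Finset (Fin n)} {x y : Fin n → ℝ}
    (h : SameSideOn a S x y) (i : Fin n) (t u : ℝ) :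
    below a S x i t ⊆ below a S y i u ∨ below a S y i u ⊆ below a S x i t := by
  by_contra! hcon
  obtain ⟨⟨j, k⟩, hp, hp'⟩ := not_subset.1 hcon.1
  obtain ⟨⟨j', k'⟩, hq, hq'⟩ := not_subset.1 hcon.2
  simp only [mem_below, not_and, not_lt] at hp hp' hq hq'
  have h1 := hp' hp.1
  have h2 := hq' hq.1
  by_cases hj : j = j'
  · subst hj
    have e1 : (k : ℝ) < k' := by linarith [hp.2]
    have e2 : (k' : ℝ) < k := by linarith [hq.2]
    linarith
  · rcases exists_gap_of_thresholds hj hp.1.2 hq.1.2 with ⟨m, hm, rfl⟩ | ⟨m, hm, rfl⟩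
    · have := (h _ hq.1.1 _ hp.1.1 m hm).1 (by have := hp.2; push_cast at this; linarith)
      have := hq.2
      push_cast at h1
      linarith
    · have := (h _ hp.1.1 _ hq.1.1 m hm).2 (by have := hq.2; push_cast at this; linarith)
      have := hp.2
      push_cast at h2
      linarith

theorem SameSideOn.below_subset {a : ℕ} {S : Finset (Fin n)} {x y : Fin n → ℝ}
    (h : SameSideOn a S x y) {i : Fin n} {t u : ℝ}
    (hc : (below a S x i t).card ≤ (below a S y i u).card) :
    below a S x i t ⊆ below a S y i u := by
  rcases h.below_total i t u with h | h
  · exact h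
  · exact (eq_of_subset_of_card_le h hc).ge

theorem IsGenericOn.injective {a : ℕ} (ha : 1 ≤ a) {x : Fin n → ℝ}
    (hx : IsGenericOn a univ x) : Function.Injective x := by
  intro i j hij
  by_contra hne
  rcases lt_or_gt_of_ne hne with h | h
  · exact hx j (mem_univ _) i (mem_univ _) 0 (mem_gaps.2 (by omega)) (by simpa using hij)
  · exact hx i (mem_univ _) j (mem_univ _) 0 (mem_gaps.2 (by omega)) (by simpa using hij.symm)

/-! ### Recovering a region from its label -/

/-- `x` takes smaller values on `S` than off `S`. -/
def IsLowerFor (S : Finset (Fin n)) (x : Fin n → ℝ) : Prop :=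
  ∀ s ∈ S, ∀ l ∉ S, x s < x l

theorem exists_next {S : Finset (Fin n)} (hS : S ≠ univ) {x : Fin n → ℝ}
    (hx : Function.Injective x) : ∃ i ∉ S, ∀ l ∉ S, l ≠ i → x i < x l := by
  have hne : (Sᶜ).Nonempty := by
    rw [nonempty_iff_ne_empty, Ne, compl_eq_empty_iff]
    exact hS
  obtain ⟨i, hi, hmin⟩ := exists_min_image Sᶜ x hne
  refine ⟨i, mem_compl.1 hi, fun l hl hli => ?_⟩
  exact lt_of_le_of_ne (hmin l (mem_compl.2 hl)) fun e => hli (hx e.symm)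

/-- The label of the next index after the lower set `S` only counts thresholds from `S`. -/
theorem pointLabel_next {a : ℕ} {S : Finset (Fin n)} {x : Fin n → ℝ} {i : Fin n}
    (h : ∀ l ∉ S, l ≠ i → x i < x l) :
    pointLabel a univ x i = (below a S x i (x i)).card := by
  unfold pointLabel
  congr 1
  refine Subset.antisymm (fun p hp => ?_) (below_mono (subset_univ _) le_rfl)
  rw [mem_below] at hp ⊢
  refine ⟨⟨?_, hp.1.2⟩, hp.2⟩
  by_contra hS
  have := h p.1 hS (ne_of_mem_gaps hp.1.2).symm
  have h0 : (0 : ℝ) ≤ p.2 := Nat.cast_nonneg _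
  linarith [hp.2]

/-- Among two points with the same labels and in the same region on a common lower set `S`, the
index following `S` for the first is not smaller than the one for the second. -/
theorem next_not_lt {a : ℕ} (ha : 1 ≤ a) {S : Finset (Fin n)} {x y : Fin n → ℝ}
    (hxy : ∀ i, pointLabel a univ x i = pointLabel a univ y i)
    (hs : SameSideOn a S x y) (hxS : IsLowerFor S x) {i l : Fin n} (hi : i ∉ S) (hl : l ∉ S)
    (hmini : ∀ m ∉ S, m ≠ i → x i < x m) (hminl : ∀ m ∉ S, m ≠ l → y l < y m) : ¬ i < l := by
  intro hil
  have h1 : below a S y i (y l) ⊆ below a S x i (x i) := by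
    refine hs.symm.below_subset ?_
    rw [← pointLabel_next hmini, hxy]
    exact card_le_card (below_mono (subset_univ _) (hminl i hi hil.ne).le)
  have hxil := hmini l hl hil.ne'
  -- the pair `(i, 0)` is a threshold of `l` below `x_l`, as `i < l` and `x_i < x_l`
  have h2 : (below a S x l (x i)).card < (below a S y l (y l)).card := by
    rw [← pointLabel_next hminl, ← hxy]
    refine card_lt_card (Finset.ssubset_iff_subset_ne.2 ⟨below_mono (subset_univ _) hxil.le, ?_⟩)
    intro e
    have hmem : (⟨i, 0⟩ : Σ _ : Fin n, ℕ) ∈ below a univ x l (x l) := by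
      exact mem_below.2 ⟨⟨mem_univ _, mem_gaps.2 (Or.inr ⟨hil, ha⟩)⟩, by simpa using hxil⟩
    rw [← e, mem_below] at hmem
    exact hi hmem.1.1
  obtain ⟨p, hp, hp'⟩ := exists_mem_notMem_of_card_lt_card h2
  rw [mem_below] at hp hp'
  have h3 : x i ≤ x p.1 + p.2 := by
    by_contra! h
    exact hp' ⟨hp.1, h⟩
  have hpos : p.2 ≠ 0 := by
    intro e
    have := hxS p.1 hp.1.1 i hi
    rw [e] at h3
    simp at h3
    linarith
  -- positive thresholds of `l` are also thresholds of the smaller index `i`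
  have h4 : p.2 ∈ gaps a i p.1 := by
    have h5 := hp.1.2
    have hne : i ≠ p.1 := fun e => hi (e ▸ hp.1.1)
    rw [mem_gaps] at h5 ⊢
    omega
  have h6 := h1 (mem_below.2 ⟨⟨hp.1.1, h4⟩, hp.2⟩)
  rw [mem_below] at h6
  linarith [h6.2]

theorem IsLowerFor.insert {S : Finset (Fin n)} {x : Fin n → ℝ} (h : IsLowerFor S x) {i : Fin n}
    (hi : ∀ l ∉ S, l ≠ i → x i < x l) : IsLowerFor (insert i S) x := by
  intro s hs l hl
  rw [mem_insert, not_or] at hl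
  rcases mem_insert.1 hs with rfl | hs
  · exact hi l hl.2 hl.1
  · exact h s hs l hl.2

/-- Two generic points with the same labels are in the same region. -/
theorem sameSideOn_of_pointLabel_eq {a : ℕ} (ha : 1 ≤ a) {x y : Fin n → ℝ}
    (hx : IsGenericOn a univ x) (hy : IsGenericOn a univ y)
    (hxy : ∀ i, pointLabel a univ x i = pointLabel a univ y i) : SameSideOn a univ x y := by
  -- the `m` smallest coordinates agree, by induction on `m`
  have key : ∀ m ≤ n, ∃ S : Finset (Fin n), S.card = m ∧ IsLowerFor S x ∧ IsLowerFor S y ∧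
      SameSideOn a S x y := by
    intro m
    induction m with
    | zero => exact fun _ => ⟨∅, by simp [IsLowerFor, SameSideOn]⟩
    | succ m ih =>
      intro hm
      obtain ⟨S, hcard, hSx, hSy, hs⟩ := ih (by omega)
      have hne : S ≠ univ := by
        rintro rfl
        simp at hcard
        omega
      obtain ⟨i, hi, hmini⟩ := exists_next hne (hx.injective ha)
      obtain ⟨l, hl, hminl⟩ := exists_next hne (hy.injective ha)
      obtain rfl : i = l := le_antisymm
        (not_lt.1 (next_not_lt ha (fun i => (hxy i).symm) hs.symm hSy hl hi hminl hmini))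
        (not_lt.1 (next_not_lt ha hxy hs hSx hi hl hmini hminl))
      have hcard' : (below a S x i (x i)).card = (below a S y i (y i)).card := by
        rw [← pointLabel_next hmini, ← pointLabel_next hminl, hxy]
      have heq : below a S x i (x i) = below a S y i (y i) :=
        (hs.below_subset hcard'.le).antisymm (hs.symm.below_subset hcard'.ge)
      refine ⟨insert i S, by rw [card_insert_of_notMem hi, hcard], hSx.insert hmini,
        hSy.insert hminl, ?_⟩
      intro p hp q hq k hk
      have hpq := ne_of_mem_gaps hk
      have hk0 : (0 : ℝ) ≤ k := Nat.cast_nonneg _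
      rcases mem_insert.1 hp with rfl | hpS
      · have hqS : q ∈ S := (mem_insert.1 hq).resolve_left hpq.symm
        have := Finset.ext_iff.1 heq ⟨q, k⟩
        simpa [mem_below, hqS, hk] using this
      · rcases mem_insert.1 hq with rfl | hqS
        · have h1 := hSx p hpS q hi
          have h2 := hSy p hpS q hi
          constructor <;> intro <;> linarith
        · exact hs p hpS q hqS k hk
  obtain ⟨S, hcard, -, -, hs⟩ := key n le_rfl
  rwa [(card_eq_iff_eq_univ S).1 (by simpa using hcard)] at hs

/-! ### Constructing a point with prescribed labels -/

/-- If `f` is a parking function, at least one index off a proper subset `S` has a value of `f`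
that is at most the number of thresholds coming from `S`. -/
theorem IsParkingFunction.exists_notMem_le {a : ℕ} {f : Fin n → ℕ} (hf : IsParkingFunction a f)
    {S : Finset (Fin n)} (hS : S ≠ univ) : ∃ l ∉ S, f l ≤ a * S.card := by
  have hlt : S.card < n := by
    simpa using card_lt_card (ssubset_univ_iff.2 hS)
  have hT : S.card <
      ((Finset.Iic (⟨S.card, hlt⟩ : Fin n)).map (Tuple.sort f).toEmbedding).card := by
    simp
  obtain ⟨l, hl, hlS⟩ := exists_mem_notMem_of_card_lt_card hT
  refine ⟨l, hlS, ?_⟩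
  obtain ⟨m, hm, rfl⟩ := mem_map.1 hl
  refine (hf m).trans (Nat.mul_le_mul_left a ?_)
  simpa [Fin.le_def] using hm

/-- The thresholds of `i` coming from `S` that are at most the real number `t`. -/
noncomputable def belowEq (a : ℕ) (S : Finset (Fin n)) (x : Fin n → ℝ) (i : Fin n) (t : ℝ) :
    Finset (Σ _ : Fin n, ℕ) :=
  (thresholds a S i).filter fun p => x p.1 + p.2 ≤ t

theorem mem_belowEq {a : ℕ} {S : Finset (Fin n)} {x : Fin n → ℝ} {i : Fin n} {t : ℝ}
    {p : Σ _ : Fin n, ℕ} :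
    p ∈ belowEq a S x i t ↔ (p.1 ∈ S ∧ p.2 ∈ gaps a i p.1) ∧ x p.1 + p.2 ≤ t := by
  simp [belowEq, thresholds]

theorem belowEq_mono {a : ℕ} {S : Finset (Fin n)} {x : Fin n → ℝ} {i : Fin n}
    {t t' : ℝ} (ht : t ≤ t') : belowEq a S x i t ⊆ belowEq a S x i t' := by
  intro p hp
  rw [mem_belowEq] at hp ⊢
  exact ⟨hp.1, hp.2.trans ht⟩

theorem card_thresholds {a : ℕ} {S : Finset (Fin n)} {i : Fin n} (hi : i ∉ S) :
    (thresholds a S i).card = a * S.card := by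
  rw [thresholds, card_sigma, sum_congr rfl fun j hj => card_gaps (a := a) (i := i) (j := j) ?_]
  · simp [mul_comm]
  · rintro rfl
    exact hi hj

/-- A place for the next coordinate: a value `t` that is not a threshold, with at most `f l`
thresholds of `l` below `t` for all `l` off `S`, and with equality for some `l`. -/
theorem exists_next_value {a : ℕ} {f : Fin n → ℕ} (hf : IsParkingFunction a f)
    {S : Finset (Fin n)} (hS : S ≠ univ) {x : Fin n → ℝ} (hx : IsGenericOn a S x) {M : ℝ}
    (hM : ∀ l ∉ S, (belowEq a S x l M).card ≤ f l) :
    ∃ t, M < t ∧ (∀ l ∉ S, ∀ p ∈ thresholds a S l, x p.1 + p.2 ≠ t) ∧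
      (∀ l ∉ S, (below a S x l t).card ≤ f l) ∧ ∃ l ∉ S, (below a S x l t).card = f l := by
  classical
  -- the values of all thresholds, and those that `t` must not exceed
  set V : Finset ℝ :=
    Sᶜ.biUnion fun l => (thresholds a S l).image fun p => x p.1 + (p.2 : ℝ) with hV
  set B : Finset ℝ := V.filter fun v => ∃ l ∉ S, f l < (belowEq a S x l v).card with hB
  have hVmem : ∀ l ∉ S, ∀ p ∈ thresholds a S l, x p.1 + (p.2 : ℝ) ∈ V := fun l hl p hp =>
    mem_biUnion.2 ⟨l, mem_compl.2 hl, mem_image_of_mem _ hp⟩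
  obtain ⟨t, htlo, hthi⟩ := Order.exists_between_finsets (insert M (V \ B)) B (by
    intro u hu v hv
    obtain ⟨l, hl, hlt⟩ := (mem_filter.1 hv).2
    by_contra! hvu
    have hcard := card_le_card (belowEq_mono (a := a) (S := S) (x := x) (i := l) hvu)
    rcases mem_insert.1 hu with rfl | hu
    · have := hM l hl
      omega
    · obtain ⟨hu, huB⟩ := mem_sdiff.1 hu
      exact huB (mem_filter.2 ⟨hu, l, hl, by omega⟩))
  have htV : ∀ l ∉ S, ∀ p ∈ thresholds a S l, x p.1 + p.2 ≠ t := by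
    intro l hl p hp e
    have hp' := hVmem l hl p hp
    rw [e] at hp'
    by_cases h : t ∈ B
    · exact lt_irrefl _ (hthi t h)
    · exact lt_irrefl _ (htlo t (mem_insert_of_mem (mem_sdiff.2 ⟨hp', h⟩)))
  have hle : ∀ l ∉ S, (below a S x l t).card ≤ f l := by
    intro l hl
    rcases (below a S x l t).eq_empty_or_nonempty with h | h
    · simp [h]
    · obtain ⟨p, hp, hmax⟩ := exists_max_image _ (fun p => x p.1 + (p.2 : ℝ)) h
      have hsub : below a S x l t ⊆ belowEq a S x l (x p.1 + p.2) := fun q hq =>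
        mem_belowEq.2 ⟨(mem_below.1 hq).1, hmax q hq⟩
      by_contra! hlt
      have hpB : x p.1 + (p.2 : ℝ) ∈ B := mem_filter.2
        ⟨hVmem l hl p (mem_filter.1 hp).1, l, hl, hlt.trans_le (card_le_card hsub)⟩
      exact (hthi _ hpB).not_gt (mem_below.1 hp).2
  refine ⟨t, htlo M (mem_insert_self _ _), htV, hle, ?_⟩
  rcases B.eq_empty_or_nonempty with hB0 | hB0
  · -- all thresholds are below `t`
    obtain ⟨l, hl, hfl⟩ := hf.exists_notMem_le hS
    refine ⟨l, hl, (hle l hl).antisymm (hfl.trans ?_)⟩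
    rw [← card_thresholds hl]
    refine card_le_card fun p hp => mem_filter.2 ⟨hp, htlo _ (mem_insert_of_mem ?_)⟩
    rw [hB0, sdiff_empty]
    exact hVmem l hl p hp
  · -- `t` lies just below the first value `v` at which some count exceeds its bound
    have hv := min'_mem B hB0
    set v := B.min' hB0 with hvdef
    obtain ⟨l, hl, hlt⟩ := (mem_filter.1 hv).2
    refine ⟨l, hl, (hle l hl).antisymm ?_⟩
    have hsub : belowEq a S x l v ⊆
        below a S x l t ∪ (thresholds a S l).filter fun p => x p.1 + p.2 = v := by
      intro p hp
      have hpt : p ∈ thresholds a S l := (mem_filter.1 hp).1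
      rw [mem_union]
      by_cases hpB : x p.1 + (p.2 : ℝ) ∈ B
      · exact Or.inr (mem_filter.2 ⟨hpt, (mem_belowEq.1 hp).2.antisymm (min'_le B _ hpB)⟩)
      · exact Or.inl (mem_filter.2 ⟨hpt, htlo _ (mem_insert_of_mem
          (mem_sdiff.2 ⟨hVmem l hl p hpt, hpB⟩))⟩)
    have hone : ((thresholds a S l).filter fun p => x p.1 + p.2 = v).card ≤ 1 := by
      refine card_le_one.2 fun p hp q hq => ?_
      rw [mem_filter] at hp hq
      exact hx.injOn_thresholds hp.1 hq.1 (hp.2.trans hq.2.symm)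
    have := (card_le_card hsub).trans (card_union_le _ _)
    omega

/-- Every parking function is the vector of labels of a generic point. -/
theorem IsParkingFunction.exists_point {a : ℕ} {f : Fin n → ℕ} (hf : IsParkingFunction a f) :
    ∃ x : Fin n → ℝ, IsGenericOn a univ x ∧ ∀ i, pointLabel a univ x i = f i := by
  -- the coordinates are chosen in increasing order; `M` is the largest one chosen so far
  have key : ∀ m ≤ n, ∃ (S : Finset (Fin n)) (x : Fin n → ℝ) (M : ℝ), S.card = m ∧
      IsGenericOn a S x ∧ (∀ i ∈ S, x i ≤ M) ∧ (∀ i ∈ S, pointLabel a S x i = f i) ∧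
      ∀ l ∉ S, (belowEq a S x l M).card ≤ f l := by
    intro m
    induction m with
    | zero =>
      exact fun _ => ⟨∅, 0, 0, by simp, by simp [IsGenericOn], by simp, by simp,
        fun l _ => by simp [belowEq, thresholds,
          show (∅ : Finset (Fin n)).sigma (gaps a l) = ∅ from rfl]⟩
    | succ m ih =>
      intro hm
      obtain ⟨S, x, M, hcard, hx, hxM, hlabel, hM⟩ := ih (by omega)
      have hne : S ≠ univ := by
        rintro rfl
        simp at hcard
        omega
      obtain ⟨t, hMt, htV, hle, hex⟩ := exists_next_value hf hne hx hM
      -- among the indices that may take the value `t`, the largest one comes first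
      obtain ⟨i, hi, himax⟩ := exists_max_image
        (Sᶜ.filter fun l => (below a S x l t).card = f l) id (by
          obtain ⟨l, hl, h⟩ := hex
          exact ⟨l, mem_filter.2 ⟨mem_compl.2 hl, h⟩⟩)
      rw [mem_filter, mem_compl] at hi
      have hyS : ∀ j ∈ S, Function.update x i t j = x j := fun j hj =>
        Function.update_of_ne (ne_of_mem_of_not_mem hj hi.1) _ _
      have hyi : Function.update x i t i = t := Function.update_self _ _ _
      set y := Function.update x i t with hy
      have hbelow : below a (insert i S) y i (y i) = below a S x i t := by
        ext p
        simp only [mem_below, hyi]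
        constructor
        · rintro ⟨⟨h1, h2⟩, h3⟩
          have h4 : p.1 ∈ S := (mem_insert.1 h1).resolve_left (ne_of_mem_gaps h2).symm
          rw [hyS _ h4] at h3
          exact ⟨⟨h4, h2⟩, h3⟩
        · rintro ⟨⟨h1, h2⟩, h3⟩
          rw [hyS _ h1]
          exact ⟨⟨mem_insert_of_mem h1, h2⟩, h3⟩
      refine ⟨insert i S, y, t, by rw [card_insert_of_notMem hi.1, hcard], ?_, ?_, ?_, ?_⟩
      · intro p hp q hq k hk
        have hpq := ne_of_mem_gaps hk
        have hk0 : (0 : ℝ) ≤ k := Nat.cast_nonneg _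
        rcases mem_insert.1 hp with rfl | hpS
        · have hqS : q ∈ S := (mem_insert.1 hq).resolve_left hpq.symm
          rw [hyS q hqS, hyi]
          exact htV p hi.1 ⟨q, k⟩ (mem_sigma.2 ⟨hqS, hk⟩)
        · rcases mem_insert.1 hq with rfl | hqS
          · rw [hyS p hpS, hyi]
            have := hxM p hpS
            intro
            linarith
          · rw [hyS p hpS, hyS q hqS]
            exact hx p hpS q hqS k hk
      · intro p hp
        rcases mem_insert.1 hp with rfl | hp
        · exact hyi.le
        · rw [hyS p hp]
          exact (hxM p hp).trans hMt.le
      · intro p hp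
        rcases mem_insert.1 hp with rfl | hp
        · rw [pointLabel, hbelow, hi.2]
        · rw [← hlabel p hp, pointLabel, pointLabel, hyS p hp]
          congr 1
          ext q
          simp only [mem_below]
          have hq0 : (0 : ℝ) ≤ q.2 := Nat.cast_nonneg _
          constructor
          · rintro ⟨⟨h1, h2⟩, h3⟩
            rcases mem_insert.1 h1 with h1 | h1
            · rw [h1, hyi] at h3
              have := hxM p hp
              linarith
            · rw [hyS _ h1] at h3
              exact ⟨⟨h1, h2⟩, h3⟩
          · rintro ⟨⟨h1, h2⟩, h3⟩
            rw [hyS _ h1]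
            exact ⟨⟨mem_insert_of_mem h1, h2⟩, h3⟩
      · intro l hl
        rw [mem_insert, not_or] at hl
        -- the only new threshold of `l` that is at most `t` is `(i, 0)`, and only if `i < l`
        have hsub : belowEq a (insert i S) y l t ⊆
            below a S x l t ∪ (if i < l then {⟨i, 0⟩} else ∅) := by
          rintro ⟨j, k⟩ hp
          rw [mem_belowEq] at hp
          obtain ⟨⟨h1, h2⟩, h3⟩ := hp
          rw [mem_union]
          rcases mem_insert.1 h1 with h1 | h1
          · right
            dsimp only at h1 h2 h3
            subst h1
            rw [hyi] at h3
            have hk : k = 0 := by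
              have : (k : ℝ) ≤ 0 := by linarith
              exact Nat.le_zero.1 (by exact_mod_cast this)
            subst hk
            have : j < l := by
              rw [mem_gaps] at h2
              omega
            simp [this]
          · left
            rw [hyS _ h1] at h3
            exact mem_below.2 ⟨⟨h1, h2⟩, h3.lt_of_ne (htV l hl.2 ⟨j, k⟩ (mem_sigma.2 ⟨h1, h2⟩))⟩
        have hcard' := (card_le_card hsub).trans (card_union_le _ _)
        have hl' := hle l hl.2
        split_ifs at hcard' with hil
        · have hne' : (below a S x l t).card ≠ f l := fun e =>
            hil.not_ge (himax l (mem_filter.2 ⟨mem_compl.2 hl.2, e⟩))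
          simp at hcard'
          omega
        · simp at hcard'
          omega
  obtain ⟨S, x, M, hcard, hx, -, hlabel, -⟩ := key n le_rfl
  obtain rfl := (card_eq_iff_eq_univ S).1 (by simpa using hcard)
  exact ⟨x, hx, fun i => hlabel i (mem_univ i)⟩

/-! ### Labels of points are parking functions -/

/-- It suffices to bound the values of `f` along some ordering of the indices, as the increasing
rearrangement is the pointwise smallest one. -/
theorem isParkingFunction_of_perm {a : ℕ} {f : Fin n → ℕ} (τ : Equiv.Perm (Fin n))
    (h : ∀ i, f (τ i) ≤ a * (i : ℕ)) : IsParkingFunction a f := by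
  intro i
  -- the `i + 1` indices `τ m` with `m ≤ i` do not all come before `i` in the sorted order
  have hc : ((Finset.Iio i).map (Tuple.sort f).toEmbedding).card <
      ((Finset.Iic i).map τ.toEmbedding).card := by simp
  obtain ⟨l, hl, hl'⟩ := exists_mem_notMem_of_card_lt_card hc
  obtain ⟨m, hm, rfl⟩ := mem_map.1 hl
  have hmi : m ≤ i := by simpa using hm
  have hge : i ≤ (Tuple.sort f).symm (τ m) := by
    by_contra! hlt
    exact hl' (mem_map.2 ⟨_, Finset.mem_Iio.2 hlt, by simp⟩)
  have h1 := Tuple.monotone_sort f hge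
  simp only [Function.comp_apply, Equiv.apply_symm_apply] at h1 ⊢
  exact h1.trans ((h m).trans (Nat.mul_le_mul_left a hmi))

theorem pointLabel_eq_sum {a : ℕ} (x : Fin n → ℝ) (i : Fin n) :
    pointLabel a univ x i = ∑ j, ((gaps a i j).filter fun k : ℕ => x j + k < x i).card := by
  rw [pointLabel, ← card_sigma]
  congr 1
  ext p
  simp [mem_below]

theorem pointLabel_le {a : ℕ} (x : Fin n → ℝ) (i : Fin n) :
    pointLabel a univ x i ≤ a * (univ.filter fun j => x j < x i).card := by
  rw [pointLabel_eq_sum, card_filter, mul_sum]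
  refine sum_le_sum fun j _ => ?_
  split_ifs with h
  · rw [mul_one]
    refine (card_filter_le _ _).trans ?_
    rw [card_gaps]
    rintro rfl
    exact lt_irrefl _ h
  · rw [mul_zero, Nat.le_zero, card_eq_zero, filter_eq_empty_iff]
    intro k _ hk
    have hk0 : (0 : ℝ) ≤ k := Nat.cast_nonneg _
    linarith

theorem isParkingFunction_pointLabel {a : ℕ} (ha : 1 ≤ a) {x : Fin n → ℝ}
    (hx : IsGenericOn a univ x) : IsParkingFunction a (pointLabel a univ x) := by
  have hmono : StrictMono (x ∘ Tuple.sort x) :=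
    (Tuple.monotone_sort x).strictMono_of_injective
      ((hx.injective ha).comp (Tuple.sort x).injective)
  refine isParkingFunction_of_perm (Tuple.sort x) fun i => ?_
  refine (pointLabel_le x _).trans (Nat.mul_le_mul_left a ?_)
  have : (univ.filter fun j => x j < x (Tuple.sort x i)) =
      (Finset.Iio i).map (Tuple.sort x).toEmbedding := by
    ext j
    obtain ⟨m, rfl⟩ := (Tuple.sort x).surjective j
    simpa using hmono.lt_iff_lt (a := m) (b := i)
  rw [this]
  simp

/-! ### Regions as cells -/

theorem mem_complement_extendedShi {a : ℕ} {x : Fin n → ℝ} :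
    x ∈ complement n (extendedShi n a) ↔ ∑ i, x i = 0 ∧ IsGenericOn a univ x := by
  refine and_congr_right fun hsum => ?_
  constructor
  · intro h i _ j _ k hk e
    refine h ?_
    rcases mem_gaps.1 hk with hk | hk
    · exact ⟨_, ⟨i, j, hk.1, k, by omega, by omega, rfl⟩, hsum, by push_cast; linarith⟩
    · exact ⟨_, ⟨j, i, hk.1, -k, by omega, by omega, rfl⟩, hsum, by push_cast; linarith⟩
  · rintro h ⟨_, ⟨i, j, hij, m, hm1, hm2, rfl⟩, -, e⟩
    rcases le_or_gt 1 m with hm | hm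
    · lift m to ℕ using by omega
      refine h i (mem_univ _) j (mem_univ _) m (mem_gaps.2 (by omega)) ?_
      push_cast at e
      linarith
    · obtain ⟨k, rfl⟩ : ∃ k : ℕ, m = -k := ⟨(-m).toNat, by omega⟩
      refine h j (mem_univ _) i (mem_univ _) k (mem_gaps.2 (by omega)) ?_
      push_cast at e
      linarith

/-- The region of a point consists of the points on the same side of every hyperplane. -/
theorem connectedComponentIn_complement {a : ℕ} {x : Fin n → ℝ}
    (hx : x ∈ complement n (extendedShi n a)) :
    connectedComponentIn (complement n (extendedShi n a)) x =
      {y | y ∈ complement n (extendedShi n a) ∧ SameSideOn a univ x y} := by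
  apply Set.Subset.antisymm
  · intro y hy
    refine ⟨connectedComponentIn_subset _ _ hy, fun i hi j hj k hk => ?_⟩
    have hC := isPreconnected_connectedComponentIn (F := complement n (extendedShi n a)) (x := x)
    have hxC := mem_connectedComponentIn hx
    have hf : Continuous fun z : Fin n → ℝ => z j + (k : ℝ) := by fun_prop
    have hg : Continuous fun z : Fin n → ℝ => z i := by fun_prop
    have hcross : ∀ z ∈ connectedComponentIn (complement n (extendedShi n a)) x,
        z j + (k : ℝ) ≠ z i := fun z hz =>
      (mem_complement_extendedShi.1 (connectedComponentIn_subset _ _ hz)).2 i hi j hj k hk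
    constructor
    · intro h
      by_contra! h'
      obtain ⟨z, hz, e⟩ :=
        hC.intermediate_value₂ hxC hy hf.continuousOn hg.continuousOn h.le h'
      exact hcross z hz e
    · intro h
      by_contra! h'
      obtain ⟨z, hz, e⟩ :=
        hC.intermediate_value₂ hy hxC hf.continuousOn hg.continuousOn h.le h'
      exact hcross z hz e
  · refine IsPreconnected.subset_connectedComponentIn (Convex.isPreconnected ?_)
      ⟨hx, fun _ _ _ _ _ _ => Iff.rfl⟩ fun y hy => hy.1
    rintro y ⟨hy, hxy⟩ z ⟨hz, hxz⟩ α β hα hβ hαβ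
    rw [mem_complement_extendedShi] at hy hz
    -- on either side of a hyperplane the affine form `w_i - w_j - k` has a constant sign
    have hval : ∀ i j (k : ℕ), (α • y + β • z) i - (α • y + β • z) j - k =
        α • (y i - y j - k) + β • (z i - z j - k) := by
      intro i j k
      simp only [Pi.add_apply, Pi.smul_apply, smul_eq_mul]
      linear_combination (k : ℝ) * hαβ
    have hside : ∀ i j, ∀ k ∈ gaps a i j,
        (x j + k < x i ∧ (α • y + β • z) j + k < (α • y + β • z) i) ∨
        (¬ x j + k < x i ∧ (α • y + β • z) i < (α • y + β • z) j + k) := by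
      intro i j k hk
      have hv := hval i j k
      have h1 := hxy i (mem_univ _) j (mem_univ _) k hk
      have h2 := hxz i (mem_univ _) j (mem_univ _) k hk
      have h3 := hy.2 i (mem_univ _) j (mem_univ _) k hk
      have h4 := hz.2 i (mem_univ _) j (mem_univ _) k hk
      by_cases h : x j + k < x i
      · have := convex_Ioi (0 : ℝ) (x := y i - y j - k) (y := z i - z j - k)
          (by have := h1.1 h; simp; linarith) (by have := h2.1 h; simp; linarith) hα hβ hαβ
        rw [Set.mem_Ioi, ← hv] at this
        exact Or.inl ⟨h, by linarith⟩
      · have h5 := lt_of_le_of_ne (not_lt.1 (mt h1.2 h)) h3.symm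
        have h6 := lt_of_le_of_ne (not_lt.1 (mt h2.2 h)) h4.symm
        have := convex_Iio (0 : ℝ) (x := y i - y j - k) (y := z i - z j - k)
          (by simp; linarith) (by simp; linarith) hα hβ hαβ
        rw [Set.mem_Iio, ← hv] at this
        exact Or.inr ⟨h, by linarith⟩
    refine ⟨mem_complement_extendedShi.2 ⟨?_, fun i _ j _ k hk => ?_⟩, fun i _ j _ k hk => ?_⟩
    · simp [sum_add_distrib, ← mul_sum, hy.1, hz.1]
    · rcases hside i j k hk with h | h
      · exact h.2.ne
      · exact h.2.ne'
    · rcases hside i j k hk with h | h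
      · exact iff_of_true h.1 h.2
      · exact iff_of_false h.1 h.2.not_gt

/-! ### The label of a region and the label of a point -/

/-- The inequality `x_i - x_j > c` for a weight `c` holds on a whole region or nowhere on it. -/
theorem SameSideOn.lt_sub_iff {a : ℕ} {x y : Fin n → ℝ} (h : SameSideOn a univ x y)
    (hx : IsGenericOn a univ x) (hy : IsGenericOn a univ y) {i j : Fin n} {c : ℤ}
    (hc : c ∈ edgeWeights a i j) : (c : ℝ) < x i - x j ↔ (c : ℝ) < y i - y j := by
  have hc' : (i < j ∧ 1 - (a : ℤ) ≤ c ∧ c ≤ a) ∨ (j < i ∧ -(a : ℤ) ≤ c ∧ c ≤ a - 1) := by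
    unfold edgeWeights at hc
    split_ifs at hc with h1 h2
    · exact Or.inl ⟨h1, Finset.mem_Icc.1 hc⟩
    · exact Or.inr ⟨h2, Finset.mem_Icc.1 hc⟩
    · simp at hc
  by_cases hg : 0 ≤ c ∧ c.toNat ∈ gaps a i j
  · obtain ⟨k, rfl⟩ := Int.eq_ofNat_of_zero_le hg.1
    have := h i (mem_univ _) j (mem_univ _) k hg.2
    push_cast
    rwa [lt_sub_iff_add_lt', lt_sub_iff_add_lt']
  · obtain ⟨k, rfl⟩ : ∃ k : ℕ, c = -k := ⟨(-c).toNat, by rw [mem_gaps] at hg; omega⟩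
    have hk : k ∈ gaps a j i := by
      rw [mem_gaps] at hg ⊢
      omega
    have h1 := h j (mem_univ _) i (mem_univ _) k hk
    have h2 := hx j (mem_univ _) i (mem_univ _) k hk
    have h3 := hy j (mem_univ _) i (mem_univ _) k hk
    push_cast
    constructor
    · intro h4
      by_contra! h5
      have := h1.2 (lt_of_le_of_ne (by linarith) h3)
      linarith
    · intro h4
      by_contra! h5
      have := h1.1 (lt_of_le_of_ne (by linarith) h2)
      linarith

theorem weight_connectedComponentIn {a : ℕ} {x : Fin n → ℝ}
    (hx : x ∈ complement n (extendedShi n a)) (i j : Fin n) :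
    weight a (connectedComponentIn (complement n (extendedShi n a)) x) i j =
      ((edgeWeights a i j).filter fun c : ℤ => (c : ℝ) < x i - x j).max := by
  classical
  unfold weight
  refine congrArg Finset.max (Finset.ext fun c => ?_)
  rw [mem_filter, mem_filter]
  refine and_congr_right fun hc => ⟨fun h => h x (mem_connectedComponentIn hx), fun h y hy => ?_⟩
  rw [connectedComponentIn_complement hx] at hy
  exact (hy.2.lt_sub_iff (mem_complement_extendedShi.1 hx).2
    (mem_complement_extendedShi.1 hy.1).2 hc).1 h

open Classical in
/-- The contribution of `j` to the label of `i` is the number of thresholds of `i` from `j` that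
are below `x_i`. -/
theorem edge_contribution {a : ℕ} (ha : 1 ≤ a) (x : Fin n → ℝ) (i j : Fin n) {w : WithBot ℤ}
    (hw : w = ((edgeWeights a i j).filter fun c : ℤ => (c : ℝ) < x i - x j).max) :
    ((if 0 ≤ w then w.unbotD 0 else 0) + (if 0 ≤ w ∧ j < i then 1 else 0) : ℤ) =
      ((gaps a i j).filter fun k : ℕ => x j + k < x i).card := by
  by_cases hlt : x j < x i
  · have hne : i ≠ j := by
      rintro rfl
      exact lt_irrefl _ hlt
    have h0 : (0 : ℤ) ∈ (edgeWeights a i j).filter fun c : ℤ => (c : ℝ) < x i - x j := by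
      refine mem_filter.2 ⟨?_, by simpa using hlt⟩
      unfold edgeWeights
      rcases hne.lt_or_gt with h | h
      · simp [h, ha]
      · simp [h, h.not_gt, ha]
    obtain ⟨m, hm⟩ := max_of_mem h0
    have hmmem := mem_filter.1 (mem_of_max hm)
    have hm0 : 0 ≤ m := le_max_of_eq h0 hm
    have hmax : ∀ c ∈ edgeWeights a i j, (c : ℝ) < x i - x j → c ≤ m := fun c hc hcx =>
      le_max_of_eq (mem_filter.2 ⟨hc, hcx⟩) hm
    rw [hm] at hw
    have hw0 : 0 ≤ w := by
      rw [hw]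
      exact_mod_cast hm0
    lift m to ℕ using hm0
    obtain ⟨hmem, hmx⟩ := hmmem
    push_cast at hmx
    have hle : ∀ k : ℕ, k ≤ m → x j + k < x i := by
      intro k hk
      have : (k : ℝ) ≤ m := Nat.cast_le.2 hk
      linarith
    rcases hne.lt_or_gt with h | h
    · have hset : ((gaps a i j).filter fun k : ℕ => x j + k < x i) = Finset.Icc 1 m := by
        simp only [edgeWeights, h, if_true, Finset.mem_Icc] at hmem hmax
        ext k
        simp only [mem_filter, mem_gaps, Finset.mem_Icc]
        constructor
        · rintro ⟨hk, hkx⟩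
          have := hmax k (by omega) (by push_cast; linarith)
          omega
        · intro hk
          exact ⟨by omega, hle k hk.2⟩
      rw [hset]
      simp [hw, h.not_gt]
    · have hset : ((gaps a i j).filter fun k : ℕ => x j + k < x i) = range (m + 1) := by
        simp only [edgeWeights, h, h.not_gt, if_true, if_false, Finset.mem_Icc] at hmem hmax
        ext k
        simp only [mem_filter, mem_gaps, mem_range]
        constructor
        · rintro ⟨hk, hkx⟩
          have := hmax k (by omega) (by push_cast; linarith)
          omega
        · intro hk
          exact ⟨by omega, hle k (by omega)⟩
      rw [hset]
      simp [hw, h]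
  · have hw0 : ¬ 0 ≤ w := by
      intro h
      obtain ⟨m, hm⟩ : ∃ m : ℤ, w = m := by
        cases w with
        | bot => simp at h
        | coe m => exact ⟨m, rfl⟩
      have hmx := (mem_filter.1 (mem_of_max (hw.symm.trans hm))).2
      rw [hm] at h
      have h' : 0 ≤ m := by exact_mod_cast h
      have : (0 : ℝ) ≤ m := by exact_mod_cast h'
      linarith
    have hset : ((gaps a i j).filter fun k : ℕ => x j + k < x i) = ∅ := by
      rw [filter_eq_empty_iff]
      intro k _ hk
      have hk0 : (0 : ℝ) ≤ k := Nat.cast_nonneg _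
      linarith
    rw [hset]
    simp [hw0]

theorem pakStanleyLabel_connectedComponentIn {a : ℕ} (ha : 1 ≤ a) {x : Fin n → ℝ}
    (hx : x ∈ complement n (extendedShi n a)) (i : Fin n) :
    pakStanleyLabel a (connectedComponentIn (complement n (extendedShi n a)) x) i =
      (pointLabel a univ x i : ℤ) := by
  classical
  rw [pakStanleyLabel, pakStanleyLabelOfWeight, pointLabel_eq_sum, sum_filter, card_filter]
  push_cast
  rw [← sum_add_distrib]
  refine sum_congr rfl fun j _ => ?_
  have := edge_contribution ha x i j (weight_connectedComponentIn hx i j)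
  unfold Precedes
  convert this

/-- Generic points can be moved into the subspace of coordinate sum zero without changing the
labels: subtract the mean. -/
theorem exists_mem_complement {a : ℕ} {x : Fin n → ℝ} (hx : IsGenericOn a univ x) :
    ∃ y ∈ complement n (extendedShi n a), ∀ i, pointLabel a univ y i = pointLabel a univ x i := by
  set c : ℝ := (∑ i, x i) / n with hc
  refine ⟨fun i => x i - c, mem_complement_extendedShi.2 ⟨?_, ?_⟩, fun i => ?_⟩
  · rcases Nat.eq_zero_or_pos n with rfl | hn
    · simp
    · have : (n : ℝ) ≠ 0 := by positivity
      simp only [sum_sub_distrib, sum_const, card_univ, Fintype.card_fin, nsmul_eq_mul]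
      rw [hc]
      field_simp
      ring
  · intro i hi j hj k hk e
    exact hx i hi j hj k hk (by linarith)
  · rw [pointLabel, pointLabel]
    congr 1
    ext p
    rw [mem_below, mem_below, sub_add_eq_add_sub, sub_lt_sub_iff_right]

end ExtShi

theorem mainTheorem4 (n a : ℕ) (ha : 1 ≤ a) :
    (∀ R ∈ ExtShi.regions n (ExtShi.extendedShi n a),
      ∃ f : Fin n → ℕ, ExtShi.IsParkingFunction a f ∧
        ∀ i, ExtShi.pakStanleyLabel a R i = (f i : ℤ)) ∧
    (∀ f : Fin n → ℕ, ExtShi.IsParkingFunction a f →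
      ∃! R : Set (Fin n → ℝ), R ∈ ExtShi.regions n (ExtShi.extendedShi n a) ∧
        ∀ i, ExtShi.pakStanleyLabel a R i = (f i : ℤ)) := by
  constructor
  · rintro _ ⟨x, hx, rfl⟩
    exact ⟨_, ExtShi.isParkingFunction_pointLabel ha (ExtShi.mem_complement_extendedShi.1 hx).2,
      ExtShi.pakStanleyLabel_connectedComponentIn ha hx⟩
  · intro f hf
    obtain ⟨x₀, hx₀, hlabel₀⟩ := hf.exists_point
    obtain ⟨x, hx, hlabel⟩ := ExtShi.exists_mem_complement hx₀
    refine ⟨_, ⟨⟨x, hx, rfl⟩, fun i => ?_⟩, ?_⟩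
    · rw [ExtShi.pakStanleyLabel_connectedComponentIn ha hx, hlabel, hlabel₀]
    · rintro _ ⟨⟨y, hy, rfl⟩, hlabely⟩
      have hs : ExtShi.SameSideOn a univ y x := by
        refine ExtShi.sameSideOn_of_pointLabel_eq ha (ExtShi.mem_complement_extendedShi.1 hy).2
          (ExtShi.mem_complement_extendedShi.1 hx).2 fun i => ?_
        have := hlabely i
        rw [ExtShi.pakStanleyLabel_connectedComponentIn ha hy] at this
        rw [hlabel, hlabel₀]
        exact_mod_cast this
      refine (connectedComponentIn_eq ?_).symm
      rw [ExtShi.connectedComponentIn_complement hx]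
      exact ⟨hy, hs.symm⟩
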